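/- Let $n\ge 1$, $0<p<1$, $\sigma,a\in\mathbb{R}$, and write $\sigma_+=\max\{\sigma,0\}$. Let $BC_a$ be the space of continuous functions $\varphi:\mathbb{R}^n\to\mathbb{R}$ with $|\varphi(x)|\le \mathrm{const}\cdot|x|^a$ as $|x|\to\infty$, with the (for $R>0$ mutually equivalent) norms $\|\varphi\|_{R,a}=\sup_{x}(R^2+|x|^2)^{-a/2}|\varphi(x)|$. Let $\mathcal{B}=(1-\Delta)^{-1}$ be the Bessel potential operator, i.e. convolution with $B(x)=\int_0^\infty e^{-s}(4\pi s)^{-n/2}e^{-|x|^2/(4s)}\,ds$, and let $\mathcal{G}(t)=e^{-t}e^{t\mathcal{B}}=e^{-t}\sum_{k\ge0}\frac{t^k}{k!}\mathcal{B}^k$ for $t\ge0$. Let $V:\mathbb{R}^n\times[0,\infty)\to[0,\infty)$ and $\Lambda:[0,\infty)\to[0,\infty)$ be continuous, and assume: (H1) there are constants $C,r$ such that $V(x,t)\le C\,\bigl(\max_{[0,t]}\Lambda\bigr)\,|x|^{\sigma_+}$ for all $|x|\ge r$ and $t\ge 0$ (this holds in particular if $V(x,t)\le C\Lambda(t)|x|^{\sigma}$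 for all $|x|\ge r$ and $t\ge0$, where $C\ge0$ and $r\ge1$); (H2) $a\ge \sigma_+/(1-p)$. Then for every $0\le u_0\in BC_a$ the Cauchy problem $\partial_t u-\Delta\partial_t u=\Delta u+V(x,t)u^p$ in $\mathbb{R}^n\times(0,\infty)$, $u(\cdot,0)=u_0$, has a global nonnegative mild solution, that is, there is $0\le u\in C([0,\infty);BC_a)$ such that for all $x\in\mathbb{R}^n$ and $t\ge 0$ $$u(x,t)=\mathcal{G}(t)u_0(x)+\int_0^t\mathcal{G}(t-\tau)\mathcal{B}\bigl[V(\cdot,\tau)u(\cdot,\tau)^p\bigr](x)\,d\tau .$$ -/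

import Mathlib

open MeasureTheory Filter Topology Set
open scoped ENNReal

noncomputable section

namespace Pseudoparabolic

/-- The space `BC_a(ℝⁿ)`: continuous functions `φ` with `|φ(x)| ≤ const * |x|^a` as
`|x| → ∞`. -/
def MemBC {n : ℕ} (a : ℝ) (φ : EuclideanSpace ℝ (Fin n) → ℝ) : Prop :=
  Continuous φ ∧ φ =O[cocompact (EuclideanSpace ℝ (Fin n))] fun x => ‖x‖ ^ a

/-- The norm `‖φ‖_{R,a} = sup_x (R² + |x|²)^(-a/2) |φ(x)|` of `BC_a` (finite on `BC_a`
for each `R > 0`; all these norms are equivalent). -/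
def weightedNorm {n : ℕ} (R a : ℝ) (φ : EuclideanSpace ℝ (Fin n) → ℝ) : ℝ :=
  ⨆ x, (R ^ 2 + ‖x‖ ^ 2) ^ (-a / 2) * |φ x|

/-- `u ∈ C([0,∞); BC_a)`, where `BC_a` carries the topology of the weighted norms. Only the
values `u t` with `t ≥ 0` matter. -/
def MemPathBC {n : ℕ} (a : ℝ) (u : ℝ → EuclideanSpace ℝ (Fin n) → ℝ) : Prop :=
  (∀ t, 0 ≤ t → MemBC a (u t)) ∧
    ∀ R, 0 < R → ∀ t, 0 ≤ t →
      Tendsto (fun s => weightedNorm R a (fun x => u s x - u t x)) (𝓝[Ici 0] t) (𝓝 0)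

/-- The heat kernel `(4πs)^(-n/2) exp(-|x|²/(4s))` on `ℝⁿ`. -/
def heatKernel {n : ℕ} (s : ℝ) (x : EuclideanSpace ℝ (Fin n)) : ℝ :=
  (4 * Real.pi * s) ^ (-(n : ℝ) / 2) * Real.exp (-‖x‖ ^ 2 / (4 * s))

/-- The Bessel kernel of order two on `ℝⁿ`, that is the convolution kernel of
`(1 - Δ)⁻¹ = ∫₀^∞ e^{-s} e^{sΔ} ds`. It equals
`(2π)^(-n/2) |x|^((2-n)/2) K_{(n-2)/2}(|x|)` for `x ≠ 0`. -/
def besselKernel {n : ℕ} (x : EuclideanSpace ℝ (Fin n)) : ℝ≥0∞ :=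
  ∫⁻ s in Ioi (0 : ℝ), ENNReal.ofReal (Real.exp (-s) * heatKernel s x)

/-- The Bessel potential operator `𝓑 = (1 - Δ)⁻¹`, that is convolution with the Bessel kernel,
acting on nonnegative functions (extended-valued, so that no convergence is presupposed). -/
def besselOp {n : ℕ} (φ : EuclideanSpace ℝ (Fin n) → ℝ≥0∞) :
    EuclideanSpace ℝ (Fin n) → ℝ≥0∞ :=
  fun x => ∫⁻ y, besselKernel (x - y) * φ y

/-- The pseudoparabolic Green operator
`𝓖(t) = e^{-t} e^{t𝓑} = e^{-t} ∑ₖ (t^k / k!) 𝓑^k`, for `t ≥ 0`, on nonnegative functions. -/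
def greenOp {n : ℕ} (t : ℝ) (φ : EuclideanSpace ℝ (Fin n) → ℝ≥0∞) :
    EuclideanSpace ℝ (Fin n) → ℝ≥0∞ :=
  fun x => ENNReal.ofReal (Real.exp (-t)) *
    ∑' k : ℕ, ENNReal.ofReal (t ^ k / (k.factorial : ℝ)) * (besselOp^[k] φ) x

/-- `u` is a global nonnegative mild solution, in `C([0,∞); BC_a)`, of
`∂ₜu - Δ∂ₜu = Δu + V u^p`, `u(·,0) = u₀`, where `V, u₀ ≥ 0`:
`u(t) = 𝓖(t)u₀ + ∫₀ᵗ 𝓖(t-τ) 𝓑(V(·,τ) u(τ)^p) dτ` at every `x ∈ ℝⁿ` and `t ≥ 0`.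
All terms are nonnegative, so the identity is stated in `[0,∞]`; as the left-hand side is
finite, it includes the convergence of the series and of the integrals. -/
def IsGlobalMildSolution {n : ℕ} (p a : ℝ) (V : EuclideanSpace ℝ (Fin n) → ℝ → ℝ)
    (u₀ : EuclideanSpace ℝ (Fin n) → ℝ) (u : ℝ → EuclideanSpace ℝ (Fin n) → ℝ) : Prop :=
  MemPathBC a u ∧ (∀ t, 0 ≤ t → ∀ x, 0 ≤ u t x) ∧
    ∀ t, 0 ≤ t → ∀ x, ENNReal.ofReal (u t x) =
      greenOp t (fun y => ENNReal.ofReal (u₀ y)) x +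
        ∫⁻ τ in Icc 0 t,
          greenOp (t - τ) (besselOp fun y => ENNReal.ofReal (V y τ * u τ y ^ p)) x

/-- The growth condition on the potential: for some constants `C` and `r`,
`V(x,t) ≤ C * (max_{[0,t]} Λ) * |x|^{σ₊}` for all `|x| ≥ r` and `t ≥ 0`. -/
def GrowthBound {n : ℕ} (σ : ℝ) (Λ : ℝ → ℝ) (V : EuclideanSpace ℝ (Fin n) → ℝ → ℝ) : Prop :=
  ∃ C r : ℝ, ∀ t, 0 ≤ t → ∀ x, r ≤ ‖x‖ → V x t ≤ C * sSup (Λ '' Icc 0 t) * ‖x‖ ^ max σ 0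

end Pseudoparabolic

end

namespace Pseudoparabolic

/-! ### Semicontinuity of integrals -/

/-! Since `u ↦ u^p` is not Lipschitz at zero, contraction is replaced by monotonicity. All operators
act on `[0,∞]`-valued functions, preserve order and commute with increasing suprema, so the Picard
iterates started from zero increase to a solution of the mild equation (`iSup_picard_eq`). It
remains to show that this solution is finite and continuous.

Finiteness comes from the weight `w_a = (1+|x|²)^(a/2)`. The Bessel kernel has an exponential
moment, whence `𝓑 w_a ≤ C w_a` (`exists_isBesselBound`). On `[0,T]` the potential is at most `m
w_{σ₊}`, and `σ₊ + a p ≤ a` is (H2). Hence `u ≤ K w_a` with `K ≥ 1` gives `V u^p ≤ m K w_a`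
(`source_le`): the source obeys a linear bound, and the bound `A e^{(C+Cm)t} w_a` reproduces itself
under the iteration (`IsBesselBound.picard_le`). Only `m` depends on `T`, not the iterates, so the
solution is global.

Continuity in `x` follows from dominated convergence once `𝓑` is known to map measurable functions
below a multiple of `w_a` to continuous ones (`continuous_besselOp`). In time the solution is
locally Lipschitz relative to `w_a` (`memPathBC_of_duhamel`). -/

theorem lowerSemicontinuous_lintegral {X Y : Type*} [TopologicalSpace X] [FirstCountableTopology X]
    [MeasurableSpace Y] {μ : Measure Y} {F : X → Y → ℝ≥0∞}
    (hF : ∀ y, LowerSemicontinuous fun x => F x y) (hm : ∀ x, Measurable (F x)) :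
    LowerSemicontinuous fun x => ∫⁻ y, F x y ∂μ := by
  refine lowerSemicontinuous_iff_le_liminf.2 fun x => ?_
  calc ∫⁻ y, F x y ∂μ ≤ ∫⁻ y, liminf (fun x' => F x' y) (𝓝 x) ∂μ :=
        lintegral_mono fun y => lowerSemicontinuous_iff_le_liminf.1 (hF y) x
    _ ≤ _ := lintegral_liminf_le hm

theorem lowerSemicontinuous_mul_const {X : Type*} [TopologicalSpace X] {f : X → ℝ≥0∞}
    (hf : LowerSemicontinuous f) {c : ℝ≥0∞} (hc : c ≠ ⊤) :
    LowerSemicontinuous fun x => f x * c :=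
  (ENNReal.continuous_mul_const hc).comp_lowerSemicontinuous hf fun _ _ h => mul_le_mul_left h c

theorem lowerSemicontinuous_toReal {X : Type*} [TopologicalSpace X] {f : X → ℝ≥0∞}
    (hf : LowerSemicontinuous f) (hfin : ∀ x, f x ≠ ⊤) :
    LowerSemicontinuous fun x => (f x).toReal := by
  intro x c hc
  rcases lt_or_ge c 0 with h | h
  · exact Eventually.of_forall fun y => h.trans_le ENNReal.toReal_nonneg
  · have := hf x (ENNReal.ofReal c) ((ENNReal.ofReal_lt_iff_lt_toReal h (hfin x)).2 hc)
    filter_upwards [this] with y hy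
    exact (ENNReal.ofReal_lt_iff_lt_toReal h (hfin y)).1 hy

/-- Two lower semicontinuous functions with continuous finite sum are continuous. -/
theorem continuous_of_lowerSemicontinuous_add {X : Type*} [TopologicalSpace X]
    {f g h : X → ℝ≥0∞} (hf : LowerSemicontinuous f) (hg : LowerSemicontinuous g)
    (hh : Continuous h) (hfin : ∀ x, h x ≠ ⊤) (hadd : ∀ x, f x + g x = h x) :
    Continuous f := by
  have hft : ∀ x, f x ≠ ⊤ := fun x hx => hfin x (by rw [← hadd, hx, top_add])
  have hgt : ∀ x, g x ≠ ⊤ := fun x hx => hfin x (by rw [← hadd, hx, add_top])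
  have hfr := lowerSemicontinuous_toReal hf hft
  have hgr := lowerSemicontinuous_toReal hg hgt
  have hhr : Continuous fun x => (h x).toReal :=
    continuous_iff_continuousAt.2 fun x =>
      (ENNReal.tendsto_toReal (hfin x)).comp hh.continuousAt
  have hng : UpperSemicontinuous fun x => -(g x).toReal :=
    continuous_neg.comp_lowerSemicontinuous_antitone hgr fun _ _ h => neg_le_neg h
  -- All values are finite, so `f = h - g`, and `-g` is upper semicontinuous.
  have hfu : UpperSemicontinuous fun x => (f x).toReal := by
    have := hhr.upperSemicontinuous.add hng
    convert! this using 2 with x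
    rw [← hadd x, ENNReal.toReal_add (hft x) (hgt x)]
    ring
  have hfc : Continuous fun x => (f x).toReal :=
    continuous_iff_lower_upperSemicontinuous.2 ⟨hfr, hfu⟩
  exact (ENNReal.continuous_ofReal.comp hfc).congr fun x => ENNReal.ofReal_toReal (hft x)

/-! ### The Bessel kernel -/

variable {n : ℕ}

local notation "𝔼" => EuclideanSpace ℝ (Fin n)

theorem heatKernel_nonneg {s : ℝ} (hs : 0 < s) (x : 𝔼) : 0 ≤ heatKernel s x := by
  unfold heatKernel; positivity

theorem measurable_heatKernel : Measurable fun z : 𝔼 × ℝ => heatKernel z.2 z.1 := by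
  unfold heatKernel; fun_prop

theorem measurable_besselKernel : Measurable (besselKernel (n := n)) := by
  unfold besselKernel
  refine Measurable.lintegral_prod_right' (f := fun z : 𝔼 × ℝ =>
    ENNReal.ofReal (Real.exp (-z.2) * heatKernel z.2 z.1)) ?_
  have := measurable_heatKernel (n := n)
  fun_prop

/-- Fatou's lemma suffices here; the singularity at the origin need not be analysed. -/
theorem lowerSemicontinuous_besselKernel : LowerSemicontinuous (besselKernel (n := n)) := by
  unfold besselKernel
  refine lowerSemicontinuous_lintegral (fun s => Continuous.lowerSemicontinuous ?_) fun x => ?_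
  · refine ENNReal.continuous_ofReal.comp ?_
    unfold heatKernel; fun_prop
  · unfold heatKernel; fun_prop

/-- Completing the square gives `|x|/2 ≤ |x|²/(8s) + s/2`. What remains is a Gaussian of doubled
variance, which accounts for `2^(n/2)`. -/
theorem lintegral_heatKernel_mul_exp_le {s : ℝ} (hs : 0 < s) :
    ∫⁻ x : 𝔼, ENNReal.ofReal (heatKernel s x * Real.exp (‖x‖ / 2)) ≤
      ENNReal.ofReal (2 ^ ((n : ℝ) / 2) * Real.exp (s / 2)) := by
  have hb : (0 : ℝ) < 1 / (8 * s) := by positivity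
  have hint := GaussianFourier.integral_rexp_neg_mul_sq_norm (V := 𝔼) hb
  have hle : ∀ x : 𝔼, heatKernel s x * Real.exp (‖x‖ / 2) ≤
      (4 * Real.pi * s) ^ (-(n : ℝ) / 2) * Real.exp (s / 2) *
        Real.exp (-(1 / (8 * s)) * ‖x‖ ^ 2) := by
    intro x
    unfold heatKernel
    rw [mul_assoc, mul_assoc _ (Real.exp _), ← Real.exp_add, ← Real.exp_add]
    refine mul_le_mul_of_nonneg_left (Real.exp_le_exp.2 ?_) (by positivity)
    have h : s / 2 + -(1 / (8 * s)) * ‖x‖ ^ 2 - (-‖x‖ ^ 2 / (4 * s) + ‖x‖ / 2) =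
        (‖x‖ - 2 * s) ^ 2 / (8 * s) := by
      field_simp; ring
    have : 0 ≤ (‖x‖ - 2 * s) ^ 2 / (8 * s) := by positivity
    linarith
  have hpos : (0 : ℝ) < (Real.pi / (1 / (8 * s))) ^ ((Module.finrank ℝ 𝔼 : ℝ) / 2) := by
    positivity
  -- A non-integrable function would have integral zero by convention, but the Gaussian integral is
  -- positive.
  have hi : Integrable fun x : 𝔼 => Real.exp (-(1 / (8 * s)) * ‖x‖ ^ 2) := by
    by_contra h
    rw [integral_undef h] at hint
    exact hpos.ne hint
  calc _ ≤ ∫⁻ x : 𝔼, ENNReal.ofReal ((4 * Real.pi * s) ^ (-(n : ℝ) / 2) * Real.exp (s / 2) *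
        Real.exp (-(1 / (8 * s)) * ‖x‖ ^ 2)) :=
        lintegral_mono fun x => ENNReal.ofReal_le_ofReal (hle x)
    _ = _ := by
      rw [← ofReal_integral_eq_lintegral_ofReal (hi.const_mul _)
        (Eventually.of_forall fun x => by positivity), integral_const_mul, hint,
        finrank_euclideanSpace_fin]
      congr 1
      have h8 : Real.pi / (1 / (8 * s)) = 2 * (4 * Real.pi * s) := by field_simp; ring
      have h4 : (0 : ℝ) < 4 * Real.pi * s := by positivity
      rw [h8, Real.mul_rpow (by norm_num) h4.le, neg_div, Real.rpow_neg h4.le]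
      field_simp

/-- By Tonelli, the growth `e^{s/2}` of the heat moment is absorbed by the factor `e^{-s}`. This one
moment controls every polynomial weight. -/
theorem lintegral_besselKernel_mul_exp_lt_top :
    ∫⁻ x : 𝔼, besselKernel x * ENNReal.ofReal (Real.exp (‖x‖ / 2)) < ⊤ := by
  have hmk := measurable_heatKernel (n := n)
  have hm : Measurable fun z : 𝔼 × ℝ =>
      ENNReal.ofReal (Real.exp (-z.2) * heatKernel z.2 z.1) := by fun_prop
  have hm1 : ∀ x : 𝔼, Measurable fun s : ℝ =>
      ENNReal.ofReal (Real.exp (-s) * heatKernel s x) := fun x =>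
    hm.comp measurable_prodMk_left
  have hswap : ∫⁻ x : 𝔼, besselKernel x * ENNReal.ofReal (Real.exp (‖x‖ / 2)) =
      ∫⁻ s in Ioi (0 : ℝ), ∫⁻ x : 𝔼, ENNReal.ofReal (Real.exp (-s) * heatKernel s x) *
        ENNReal.ofReal (Real.exp (‖x‖ / 2)) := by
    rw [← lintegral_lintegral_swap]
    · refine lintegral_congr fun x => ?_
      rw [besselKernel, lintegral_mul_const _ (hm1 x)]
    · refine Measurable.aemeasurable (hm.mul ?_)
      fun_prop
  have hi : IntegrableOn (fun s : ℝ => Real.exp (-(1 / 2) * s)) (Ioi 0) :=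
    exp_neg_integrableOn_Ioi 0 (by norm_num)
  rw [hswap]
  calc _ ≤ ∫⁻ s in Ioi (0 : ℝ), ENNReal.ofReal (2 ^ ((n : ℝ) / 2) * Real.exp (-(1 / 2) * s)) := by
        refine setLIntegral_mono (by fun_prop) fun s hs => ?_
        have hs : 0 < s := hs
        have h1 : ∀ x : 𝔼, ENNReal.ofReal (Real.exp (-s) * heatKernel s x) *
            ENNReal.ofReal (Real.exp (‖x‖ / 2)) = ENNReal.ofReal (Real.exp (-s)) *
              ENNReal.ofReal (heatKernel s x * Real.exp (‖x‖ / 2)) := by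
          intro x
          rw [ENNReal.ofReal_mul (Real.exp_nonneg _), mul_assoc,
            ← ENNReal.ofReal_mul (heatKernel_nonneg hs x)]
        simp_rw [h1]
        rw [lintegral_const_mul' _ _ ENNReal.ofReal_ne_top]
        refine (mul_le_mul_right (lintegral_heatKernel_mul_exp_le hs) _).trans_eq ?_
        rw [← ENNReal.ofReal_mul (Real.exp_nonneg _), mul_left_comm, ← Real.exp_add]
        congr 3
        ring
    _ < ⊤ := (hi.const_mul _).lintegral_lt_top

/-! ### The weight -/

/-- The weight `(1 + |x|²)^(a/2)`. -/
noncomputable def weight (a : ℝ) (x : 𝔼) : ℝ := (1 + ‖x‖ ^ 2) ^ (a / 2)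

theorem weight_pos (a : ℝ) (x : 𝔼) : 0 < weight a x := by unfold weight; positivity

theorem one_le_weight {a : ℝ} (ha : 0 ≤ a) (x : 𝔼) : 1 ≤ weight a x :=
  Real.one_le_rpow (by nlinarith [sq_nonneg ‖x‖]) (by positivity)

theorem norm_rpow_le_weight {a : ℝ} (ha : 0 ≤ a) (x : 𝔼) : ‖x‖ ^ a ≤ weight a x := by
  calc ‖x‖ ^ a = (‖x‖ ^ (2 : ℝ)) ^ (a / 2) := by
        rw [← Real.rpow_mul (norm_nonneg x)]; congr 1; ring
    _ ≤ _ := by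
        refine Real.rpow_le_rpow (by positivity) ?_ (by positivity)
        rw [Real.rpow_two]; linarith

theorem continuous_weight (a : ℝ) : Continuous (weight (n := n) a) := by
  unfold weight
  refine Continuous.rpow_const (by fun_prop) fun x => Or.inl ?_
  positivity

/-- Peetre's inequality, from `1+|x-y|² ≤ 2(1+|x|²)(1+|y|²)`; it pulls the weight out of a
convolution. -/
theorem weight_sub_le {a : ℝ} (ha : 0 ≤ a) (x y : 𝔼) :
    weight a (x - y) ≤ 2 ^ (a / 2) * weight a x * weight a y := by
  unfold weight
  rw [← Real.mul_rpow (by norm_num) (by positivity),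
    ← Real.mul_rpow (by positivity) (by positivity)]
  refine Real.rpow_le_rpow (by positivity) ?_ (by positivity)
  have h := norm_sub_le x y
  have h2 : ‖x - y‖ ^ 2 ≤ (‖x‖ + ‖y‖) ^ 2 := by gcongr
  nlinarith [sq_nonneg (‖x‖ - ‖y‖), mul_nonneg (sq_nonneg ‖x‖) (sq_nonneg ‖y‖)]

theorem exists_weight_le_exp {a : ℝ} (ha : 0 ≤ a) :
    ∃ c : ℝ, 0 ≤ c ∧ ∀ x : 𝔼, weight a x ≤ c * Real.exp (‖x‖ / 2) := by
  set N := ⌈a⌉₊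
  -- With `N ≥ a`, the power `((1+|x|)/2)^N / N!` is a single term of the series of `e^{(1+|x|)/2}`.
  refine ⟨2 ^ N * N.factorial * Real.exp (1 / 2), by positivity, fun x => ?_⟩
  have hx := norm_nonneg x
  have h1 : weight a x ≤ (1 + ‖x‖) ^ N := by
    calc weight a x ≤ ((1 + ‖x‖) ^ (2 : ℝ)) ^ (a / 2) := by
          unfold weight
          refine Real.rpow_le_rpow (by positivity) ?_ (by positivity)
          rw [Real.rpow_two]
          nlinarith
      _ = (1 + ‖x‖) ^ a := by
          rw [← Real.rpow_mul (by positivity)]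
          congr 1
          ring
      _ ≤ (1 + ‖x‖) ^ (N : ℝ) := Real.rpow_le_rpow_of_exponent_le (by linarith) (Nat.le_ceil a)
      _ = _ := Real.rpow_natCast _ _
  have h2 := Real.pow_div_factorial_le_exp ((1 + ‖x‖) / 2) (by positivity) N
  rw [div_pow, div_div, div_le_iff₀ (by positivity), add_div, Real.exp_add] at h2
  calc _ ≤ _ := h1
    _ ≤ _ := h2
    _ = _ := by ring

/-! ### The Bessel potential operator -/

theorem measurable_besselOp_param {P : Type*} [MeasurableSpace P] {F : P → 𝔼 → ℝ≥0∞}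
    (hF : Measurable (Function.uncurry F)) :
    Measurable (Function.uncurry fun q x => besselOp (F q) x) := by
  unfold besselOp
  have hk := measurable_besselKernel (n := n)
  refine Measurable.lintegral_prod_right' (f := fun z : (P × 𝔼) × 𝔼 =>
    besselKernel (z.1.2 - z.2) * Function.uncurry F (z.1.1, z.2)) ?_
  fun_prop

theorem measurable_besselOp_iterate_param {P : Type*} [MeasurableSpace P] {F : P → 𝔼 → ℝ≥0∞}
    (hF : Measurable (Function.uncurry F)) (k : ℕ) :
    Measurable (Function.uncurry fun q x => besselOp^[k] (F q) x) := by
  induction k with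
  | zero => simpa using hF
  | succ k ih =>
    simp only [Function.iterate_succ_apply']
    exact measurable_besselOp_param ih

theorem measurable_besselOp {φ : 𝔼 → ℝ≥0∞} (hφ : Measurable φ) : Measurable (besselOp φ) := by
  unfold besselOp
  have hk := measurable_besselKernel (n := n)
  refine Measurable.lintegral_prod_right' (f := fun z : 𝔼 × 𝔼 =>
    besselKernel (z.1 - z.2) * φ z.2) ?_
  fun_prop

theorem measurable_besselOp_iterate {φ : 𝔼 → ℝ≥0∞} (hφ : Measurable φ) (k : ℕ) :
    Measurable (besselOp^[k] φ) := by
  induction k with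
  | zero => exact hφ
  | succ k ih => rw [Function.iterate_succ_apply']; exact measurable_besselOp ih

theorem besselOp_mono : Monotone (besselOp (n := n)) := fun _ _ h _ =>
  lintegral_mono fun y => mul_le_mul_right (h y) _

theorem besselOp_iSup {φ : ℕ → 𝔼 → ℝ≥0∞} (hφ : ∀ j, Measurable (φ j)) (hmono : Monotone φ)
    (x : 𝔼) : besselOp (fun y => ⨆ j, φ j y) x = ⨆ j, besselOp (φ j) x := by
  unfold besselOp
  simp_rw [ENNReal.mul_iSup]
  have hk := measurable_besselKernel (n := n)
  refine lintegral_iSup (fun j => ?_) fun i j hij y => mul_le_mul_right (hmono hij y) _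
  have := hφ j
  fun_prop

theorem besselOp_iterate_iSup {φ : ℕ → 𝔼 → ℝ≥0∞} (hφ : ∀ j, Measurable (φ j))
    (hmono : Monotone φ) (k : ℕ) (x : 𝔼) :
    besselOp^[k] (fun y => ⨆ j, φ j y) x = ⨆ j, besselOp^[k] (φ j) x := by
  induction k generalizing x with
  | zero => rfl
  | succ k ih =>
    simp only [Function.iterate_succ_apply']
    rw [funext ih]
    exact besselOp_iSup (fun j => measurable_besselOp_iterate (hφ j) k)
      (fun i j hij => besselOp_mono.iterate k (hmono hij)) x

/-- `C` bounds the operator norm of the Bessel potential on functions weighted by `weight a`. -/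
def IsBesselBound (n : ℕ) (a C : ℝ) : Prop :=
  1 ≤ C ∧ ∀ (φ : EuclideanSpace ℝ (Fin n) → ℝ≥0∞) (M : ℝ), 0 ≤ M →
      (∀ y, φ y ≤ ENNReal.ofReal (M * weight a y)) →
      ∀ x, besselOp φ x ≤ ENNReal.ofReal (C * M * weight a x)

theorem exists_isBesselBound {a : ℝ} (ha : 0 ≤ a) :
    ∃ C : ℝ, IsBesselBound n a C := by
  obtain ⟨c, hc, hw⟩ := exists_weight_le_exp (n := n) ha
  set I := ∫⁻ x : 𝔼, besselKernel x * ENNReal.ofReal (Real.exp (‖x‖ / 2))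
  have hI : I < ⊤ := lintegral_besselKernel_mul_exp_lt_top
  -- The moment of the kernel and Peetre's inequality give the first summand; the added 1 secures `1
  -- ≤ C`.
  refine ⟨2 ^ (a / 2) * c * I.toReal + 1, le_add_of_nonneg_left (by positivity),
    fun φ M hM hφ x => ?_⟩
  have hk := measurable_besselKernel (n := n)
  have hx := weight_pos a x
  calc besselOp φ x ≤ ∫⁻ y, besselKernel (x - y) * ENNReal.ofReal (M * weight a y) :=
        lintegral_mono fun y => mul_le_mul_right (hφ y) _
    _ = ∫⁻ z, besselKernel z * ENNReal.ofReal (M * weight a (x - z)) := by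
        rw [← lintegral_sub_left_eq_self _ x]
        simp
    _ ≤ ∫⁻ z, ENNReal.ofReal (2 ^ (a / 2) * c * M * weight a x) *
          (besselKernel z * ENNReal.ofReal (Real.exp (‖z‖ / 2))) := by
        refine lintegral_mono fun z => ?_
        rw [mul_left_comm, ← ENNReal.ofReal_mul (by positivity)]
        refine mul_le_mul_right (ENNReal.ofReal_le_ofReal ?_) _
        calc M * weight a (x - z) ≤ M * (2 ^ (a / 2) * weight a x * weight a z) := by
              gcongr
              exact weight_sub_le ha x z
          _ ≤ M * (2 ^ (a / 2) * weight a x * (c * Real.exp (‖z‖ / 2))) := by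
              gcongr
              exact hw z
          _ = _ := by ring
    _ = ENNReal.ofReal (2 ^ (a / 2) * c * M * weight a x) * ENNReal.ofReal I.toReal := by
        rw [lintegral_const_mul' _ _ ENNReal.ofReal_ne_top, ENNReal.ofReal_toReal hI.ne]
    _ ≤ _ := by
        rw [← ENNReal.ofReal_mul (by positivity)]
        refine ENNReal.ofReal_le_ofReal ?_
        nlinarith [mul_nonneg hM hx.le]

theorem IsBesselBound.iterate_le {a C : ℝ} (hC : IsBesselBound n a C) {φ : 𝔼 → ℝ≥0∞} {M : ℝ}
    (hM : 0 ≤ M) (hφ : ∀ y, φ y ≤ ENNReal.ofReal (M * weight a y)) (k : ℕ) (x : 𝔼) :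
    besselOp^[k] φ x ≤ ENNReal.ofReal (C ^ k * M * weight a x) := by
  induction k generalizing x with
  | zero => simpa using hφ x
  | succ k ih =>
    have h0 : 0 ≤ C := zero_le_one.trans hC.1
    rw [Function.iterate_succ_apply', pow_succ', mul_assoc C]
    exact hC.2 _ _ (by positivity) ih x

/-! ### Continuity of dominated integrals -/

/-- Near a point `x` the factor `w` stays below `w x + 1`, so one majorant serves for dominated
convergence. The measure is arbitrary, which covers convolutions, series and time integrals alike.
-/
theorem continuous_lintegral_of_le {X Y : Type*} [TopologicalSpace X] [FirstCountableTopology X]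
    [MeasurableSpace Y] {μ : Measure Y} {F : X → Y → ℝ≥0∞} {w : X → ℝ} {M : Y → ℝ≥0∞}
    (hF : ∀ᵐ y ∂μ, Continuous fun x => F x y) (hm : ∀ x, Measurable (F x)) (hw : Continuous w)
    (hle : ∀ x, ∀ᵐ y ∂μ, F x y ≤ M y * ENNReal.ofReal (w x)) (hM : ∫⁻ y, M y ∂μ ≠ ⊤) :
    Continuous fun x => ∫⁻ y, F x y ∂μ := by
  refine continuous_iff_continuousAt.2 fun x => ?_
  refine tendsto_lintegral_filter_of_dominated_convergence
    (fun y => M y * ENNReal.ofReal (w x + 1)) (Eventually.of_forall hm) ?_ ?_ ?_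
  · filter_upwards [hw.continuousAt.eventually (gt_mem_nhds (lt_add_one (w x)))] with z hz
    filter_upwards [hle z] with y hy
    exact hy.trans (mul_le_mul_right (ENNReal.ofReal_le_ofReal hz.le) _)
  · rw [lintegral_mul_const' _ _ ENNReal.ofReal_ne_top]
    exact ENNReal.mul_ne_top hM ENNReal.ofReal_ne_top
  · filter_upwards [hF] with y hy using hy.continuousAt

theorem continuous_besselOp_weight {a : ℝ} (ha : 0 ≤ a) (M : ℝ) :
    Continuous (besselOp fun y : 𝔼 => ENNReal.ofReal (M * weight a y)) := by
  obtain ⟨c, hc, hw⟩ := exists_weight_le_exp (n := n) ha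
  have hI := lintegral_besselKernel_mul_exp_lt_top (n := n)
  have hk := measurable_besselKernel (n := n)
  have hcw := continuous_weight (n := n) a
  have hmw := hcw.measurable
  have hfin : ∀ᵐ z : 𝔼, besselKernel z < ⊤ := by
    filter_upwards [ae_lt_top (by fun_prop) hI.ne] with z hz
    by_contra h
    rw [not_lt_top_iff.1 h, ENNReal.top_mul (by simp [Real.exp_pos])] at hz
    exact lt_irrefl _ hz
  -- After translation `x` enters only through the continuous weight, so the kernel need only be
  -- finite almost everywhere.
  have heq : (besselOp fun y : 𝔼 => ENNReal.ofReal (M * weight a y)) = fun x =>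
      ∫⁻ z, besselKernel z * ENNReal.ofReal (M * weight a (x - z)) := by
    funext x
    rw [besselOp, ← lintegral_sub_left_eq_self _ x]
    simp
  rw [heq]
  refine continuous_lintegral_of_le (w := fun x => |M| * (2 ^ (a / 2) * c) * weight a x)
    (M := fun z => besselKernel z * ENNReal.ofReal (Real.exp (‖z‖ / 2))) ?_ (fun x => ?_)
    (by fun_prop) (fun x => Eventually.of_forall fun z => ?_) hI.ne
  · filter_upwards [hfin] with z hz
    exact (ENNReal.continuous_const_mul hz.ne).comp (ENNReal.continuous_ofReal.comp (by fun_prop))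
  · fun_prop
  · rw [mul_assoc, ← ENNReal.ofReal_mul (Real.exp_nonneg _)]
    refine mul_le_mul_right (ENNReal.ofReal_le_ofReal ?_) _
    have hx := weight_pos a x
    calc M * weight a (x - z) ≤ |M| * (2 ^ (a / 2) * weight a x * weight a z) :=
          mul_le_mul (le_abs_self M) (weight_sub_le ha x z) (weight_pos _ _).le (abs_nonneg M)
      _ ≤ |M| * (2 ^ (a / 2) * weight a x * (c * Real.exp (‖z‖ / 2))) := by
          gcongr
          exact hw z
      _ = _ := by ring

theorem lowerSemicontinuous_besselOp {φ : 𝔼 → ℝ≥0∞} (hφ : Measurable φ) (hfin : ∀ x, φ x ≠ ⊤) :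
    LowerSemicontinuous (besselOp φ) := by
  have hk := measurable_besselKernel (n := n)
  refine lowerSemicontinuous_lintegral (fun y => ?_) fun x => by fun_prop
  exact lowerSemicontinuous_mul_const
    (lowerSemicontinuous_besselKernel.comp (by fun_prop)) (hfin y)

/-- The images of `φ` and of `M w_a - φ` are both lower semicontinuous and add up to the continuous
image of `M w_a`. Hence measurability of `φ` is enough. -/
theorem continuous_besselOp {a : ℝ} (ha : 0 ≤ a) {φ : 𝔼 → ℝ≥0∞} (hφ : Measurable φ) {M : ℝ}
    (hM : 0 ≤ M) (hle : ∀ y, φ y ≤ ENNReal.ofReal (M * weight a y)) :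
    Continuous (besselOp φ) := by
  obtain ⟨C, hC⟩ := exists_isBesselBound (n := n) ha
  have hmw := (continuous_weight (n := n) a).measurable
  have hk := measurable_besselKernel (n := n)
  refine continuous_of_lowerSemicontinuous_add
    (g := besselOp fun y => ENNReal.ofReal (M * weight a y) - φ y)
    (lowerSemicontinuous_besselOp hφ fun x => ne_top_of_le_ne_top ENNReal.ofReal_ne_top (hle x))
    (lowerSemicontinuous_besselOp (by fun_prop)
      fun x => ne_top_of_le_ne_top ENNReal.ofReal_ne_top tsub_le_self)
    (continuous_besselOp_weight ha M)
    (fun x => ne_top_of_le_ne_top ENNReal.ofReal_ne_top (hC.2 _ M hM (fun y => le_rfl) x))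
    fun x => ?_
  unfold besselOp
  rw [← lintegral_add_left (by fun_prop)]
  refine lintegral_congr fun y => ?_
  rw [← mul_add, add_tsub_cancel_of_le (hle y)]

theorem continuous_besselOp_iterate {a : ℝ} (ha : 0 ≤ a) {φ : 𝔼 → ℝ≥0∞} (hφ : Continuous φ)
    {M : ℝ} (hM : 0 ≤ M) (hle : ∀ y, φ y ≤ ENNReal.ofReal (M * weight a y)) (k : ℕ) :
    Continuous (besselOp^[k] φ) := by
  obtain ⟨C, hC⟩ := exists_isBesselBound (n := n) ha
  have h0 : 0 ≤ C := zero_le_one.trans hC.1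
  cases k with
  | zero => exact hφ
  | succ k =>
    rw [Function.iterate_succ_apply']
    exact continuous_besselOp ha (measurable_besselOp_iterate hφ.measurable k)
      (M := C ^ k * M) (by positivity) (hC.iterate_le hM hle k)

/-! ### The Green operator -/

theorem measurable_greenOp_param {P : Type*} [MeasurableSpace P] {F : P → 𝔼 → ℝ≥0∞}
    (hF : Measurable (Function.uncurry F)) {T : P → ℝ} (hT : Measurable T) :
    Measurable (Function.uncurry fun q x => greenOp (T q) (F q) x) := by
  unfold greenOp
  have h := measurable_besselOp_iterate_param hF
  simp only [Function.uncurry_def] at h ⊢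
  refine Measurable.mul (by fun_prop) (Measurable.tsum fun k => Measurable.mul ?_ (h k))
  fun_prop

theorem greenOp_mono (t : ℝ) : Monotone (greenOp (n := n) t) := fun _ _ h x =>
  mul_le_mul_right (ENNReal.tsum_le_tsum fun k =>
    mul_le_mul_right (besselOp_mono.iterate k h x) _) _

theorem greenOp_iSup (t : ℝ) {φ : ℕ → 𝔼 → ℝ≥0∞} (hφ : ∀ j, Measurable (φ j))
    (hmono : Monotone φ) (x : 𝔼) :
    greenOp t (fun y => ⨆ j, φ j y) x = ⨆ j, greenOp t (φ j) x := by
  unfold greenOp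
  rw [← ENNReal.mul_iSup]
  congr 1
  -- Read as an integral against counting measure, the series admits monotone convergence.
  simp_rw [besselOp_iterate_iSup hφ hmono, ENNReal.mul_iSup, ← lintegral_count]
  exact lintegral_iSup (fun j => measurable_from_top)
    fun i j hij k => mul_le_mul_right (besselOp_mono.iterate k (hmono hij) x) _

theorem hasSum_pow_div_factorial_mul (t C K : ℝ) :
    HasSum (fun k : ℕ => t ^ k / (k.factorial : ℝ) * (C ^ k * K)) (Real.exp (C * t) * K) := by
  have h := NormedSpace.expSeries_div_hasSum_exp (C * t)
  rw [← Real.exp_eq_exp_ℝ] at h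
  refine (h.mul_right K).congr_fun ?_
  intro k
  rw [mul_pow]
  ring

theorem IsBesselBound.greenOp_le {a C : ℝ} (hC : IsBesselBound n a C) {φ : 𝔼 → ℝ≥0∞} {M : ℝ}
    (hM : 0 ≤ M) (hφ : ∀ y, φ y ≤ ENNReal.ofReal (M * weight a y)) {t : ℝ} (ht : 0 ≤ t) (x : 𝔼) :
    greenOp t φ x ≤ ENNReal.ofReal (Real.exp (C * t) * (M * weight a x)) := by
  have h0 : 0 ≤ C := zero_le_one.trans hC.1
  have hx := weight_pos a x
  have hs := hasSum_pow_div_factorial_mul t C (M * weight a x)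
  calc greenOp t φ x ≤ 1 * ∑' k : ℕ, ENNReal.ofReal
        (t ^ k / (k.factorial : ℝ) * (C ^ k * (M * weight a x))) := by
        refine mul_le_mul' (ENNReal.ofReal_le_one.2 (Real.exp_le_one_iff.2 (by linarith)))
          (ENNReal.tsum_le_tsum fun k => ?_)
        rw [ENNReal.ofReal_mul (by positivity), ← mul_assoc (C ^ k)]
        exact mul_le_mul_right (hC.iterate_le hM hφ k x) _
    _ = _ := by
        rw [one_mul, ← ENNReal.ofReal_tsum_of_nonneg (fun k => by positivity) hs.summable,
          hs.tsum_eq]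

theorem exp_sub_exp_le (x y : ℝ) : Real.exp y - Real.exp x ≤ Real.exp y * (y - x) := by
  have h : Real.exp x = Real.exp y * Real.exp (x - y) := by
    rw [← Real.exp_add]; ring_nf
  nlinarith [Real.add_one_le_exp (x - y), Real.exp_pos y]

/-- `e^t 𝓖(t)` is a power series in `t` with nonnegative terms, hence increasing. With
`IsBesselBound.greenOp_le_add` this bounds time increments from both sides without subtraction in
`[0,∞]`. -/
theorem greenOp_le_exp_mul (φ : 𝔼 → ℝ≥0∞) {s t : ℝ} (hs : 0 ≤ s) (hst : s ≤ t) (x : 𝔼) :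
    greenOp s φ x ≤ ENNReal.ofReal (Real.exp (t - s)) * greenOp t φ x := by
  unfold greenOp
  rw [← mul_assoc, ← ENNReal.ofReal_mul (Real.exp_nonneg _), ← Real.exp_add]
  refine mul_le_mul' (le_of_eq ?_) (ENNReal.tsum_le_tsum fun k => ?_)
  · congr 2; ring
  · refine mul_le_mul_left (ENNReal.ofReal_le_ofReal ?_) _
    gcongr

/-- The termwise increments `(t^k - s^k)/k!` against `C^k` sum to `e^{Ct} - e^{Cs} ≤ e^{Ct} C
(t-s)`. -/
theorem IsBesselBound.greenOp_le_add {a C : ℝ} (hC : IsBesselBound n a C) {φ : 𝔼 → ℝ≥0∞} {M : ℝ}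
    (hM : 0 ≤ M) (hφ : ∀ y, φ y ≤ ENNReal.ofReal (M * weight a y)) {s t : ℝ} (hs : 0 ≤ s)
    (hst : s ≤ t) (x : 𝔼) :
    greenOp t φ x ≤ greenOp s φ x +
      ENNReal.ofReal (Real.exp (C * t) * (C * (t - s)) * (M * weight a x)) := by
  have h0 : 0 ≤ C := zero_le_one.trans hC.1
  have hx := weight_pos a x
  have hsum := (hasSum_pow_div_factorial_mul t C (M * weight a x)).sub
    (hasSum_pow_div_factorial_mul s C (M * weight a x))
  have hnn : ∀ k : ℕ, 0 ≤ t ^ k / (k.factorial : ℝ) - s ^ k / (k.factorial : ℝ) := fun k => by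
    rw [sub_nonneg]; gcongr
  calc greenOp t φ x ≤ ENNReal.ofReal (Real.exp (-s)) * ∑' k : ℕ,
        (ENNReal.ofReal (s ^ k / (k.factorial : ℝ)) * (besselOp^[k] φ) x +
          ENNReal.ofReal (t ^ k / (k.factorial : ℝ) * (C ^ k * (M * weight a x)) -
            s ^ k / (k.factorial : ℝ) * (C ^ k * (M * weight a x)))) := by
        refine mul_le_mul' (ENNReal.ofReal_le_ofReal (Real.exp_le_exp.2 (by linarith)))
          (ENNReal.tsum_le_tsum fun k => ?_)
        calc _ = ENNReal.ofReal (s ^ k / (k.factorial : ℝ)) * (besselOp^[k] φ) x +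
            ENNReal.ofReal (t ^ k / (k.factorial : ℝ) - s ^ k / (k.factorial : ℝ)) *
              (besselOp^[k] φ) x := by
              rw [← add_mul, ← ENNReal.ofReal_add (by positivity) (hnn k), add_sub_cancel]
          _ ≤ _ := by
              rw [← sub_mul, ENNReal.ofReal_mul (hnn k), ← mul_assoc (C ^ k)]
              exact add_le_add_right (mul_le_mul_right (hC.iterate_le hM hφ k x) _) _
    _ = greenOp s φ x + ENNReal.ofReal (Real.exp (-s)) * ENNReal.ofReal
          (Real.exp (C * t) * (M * weight a x) - Real.exp (C * s) * (M * weight a x)) := by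
        rw [ENNReal.tsum_add, mul_add, ← hsum.tsum_eq,
          ENNReal.ofReal_tsum_of_nonneg (fun k => ?_) hsum.summable]
        · rfl
        · rw [← sub_mul]
          have := hnn k
          positivity
    _ ≤ _ := by
        gcongr
        rw [← ENNReal.ofReal_mul (Real.exp_nonneg _)]
        refine ENNReal.ofReal_le_ofReal ?_
        have h1 : Real.exp (-s) ≤ 1 := Real.exp_le_one_iff.2 (by linarith)
        have h2 := exp_sub_exp_le (C * s) (C * t)
        have h3 : 0 ≤ Real.exp (C * t) - Real.exp (C * s) :=
          sub_nonneg.2 (Real.exp_le_exp.2 (by gcongr))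
        calc _ = Real.exp (-s) * ((Real.exp (C * t) - Real.exp (C * s)) * (M * weight a x)) := by
              ring
          _ ≤ 1 * ((Real.exp (C * t) - Real.exp (C * s)) * (M * weight a x)) := by gcongr
          _ ≤ 1 * ((Real.exp (C * t) * (C * t - C * s)) * (M * weight a x)) := by gcongr
          _ = _ := by ring

theorem IsBesselBound.continuous_greenOp {a C : ℝ} (hC : IsBesselBound n a C) (ha : 0 ≤ a)
    {φ : 𝔼 → ℝ≥0∞} (hφc : Continuous φ) {M : ℝ} (hM : 0 ≤ M)
    (hφ : ∀ y, φ y ≤ ENNReal.ofReal (M * weight a y)) {t : ℝ} (ht : 0 ≤ t) :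
    Continuous (greenOp t φ) := by
  have h0 : 0 ≤ C := zero_le_one.trans hC.1
  have hs := hasSum_pow_div_factorial_mul t C M
  refine (ENNReal.continuous_const_mul ENNReal.ofReal_ne_top).comp ?_
  simp_rw [← lintegral_count]
  refine continuous_lintegral_of_le (w := weight a)
    (M := fun k : ℕ => ENNReal.ofReal (t ^ k / (k.factorial : ℝ) * (C ^ k * M)))
    (Eventually.of_forall fun k => ?_) (fun x => measurable_from_top) (continuous_weight a)
    (fun x => Eventually.of_forall fun k => ?_) ?_
  · exact (ENNReal.continuous_const_mul ENNReal.ofReal_ne_top).comp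
      (continuous_besselOp_iterate ha hφc hM hφ k)
  · rw [ENNReal.ofReal_mul (by positivity), mul_assoc, ← ENNReal.ofReal_mul (by positivity)]
    exact mul_le_mul_right (hC.iterate_le hM hφ k x) _
  · rw [lintegral_count, ← ENNReal.ofReal_tsum_of_nonneg (fun k => by positivity) hs.summable]
    exact ENNReal.ofReal_ne_top

/-! ### The Duhamel operator -/

/-- The Duhamel term `∫₀ᵗ 𝓖(t-τ) 𝓑 f(τ) dτ`. -/
noncomputable def duhamel (f : ℝ → 𝔼 → ℝ≥0∞) (t : ℝ) (x : 𝔼) : ℝ≥0∞ :=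
  ∫⁻ τ in Icc 0 t, greenOp (t - τ) (besselOp (f τ)) x

theorem measurable_duhamel_integrand {f : ℝ → 𝔼 → ℝ≥0∞} (hf : Measurable (Function.uncurry f)) :
    Measurable fun z : (ℝ × 𝔼) × ℝ => greenOp (z.1.1 - z.2) (besselOp (f z.2)) z.1.2 := by
  have h1 := measurable_besselOp_param hf
  have h2 : Measurable (Function.uncurry fun (q : ℝ × ℝ) (y : 𝔼) => besselOp (f q.2) y) :=
    h1.comp (f := fun z : (ℝ × ℝ) × 𝔼 => (z.1.2, z.2)) (by fun_prop)
  have h3 := measurable_greenOp_param h2 (T := fun q : ℝ × ℝ => q.1 - q.2) (by fun_prop)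
  exact h3.comp (f := fun z : (ℝ × 𝔼) × ℝ => ((z.1.1, z.2), z.1.2)) (by fun_prop)

theorem measurable_duhamel_integrand_right {f : ℝ → 𝔼 → ℝ≥0∞}
    (hf : Measurable (Function.uncurry f)) (t : ℝ) (x : 𝔼) :
    Measurable fun τ : ℝ => greenOp (t - τ) (besselOp (f τ)) x :=
  (measurable_duhamel_integrand hf).comp (f := fun τ : ℝ => ((t, x), τ)) (by fun_prop)

theorem measurable_duhamel {f : ℝ → 𝔼 → ℝ≥0∞} (hf : Measurable (Function.uncurry f)) :
    Measurable (Function.uncurry (duhamel f)) := by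
  -- The moving domain `[0,t]` becomes an indicator, so that the integrand is jointly measurable on
  -- a fixed space.
  have h : Function.uncurry (duhamel f) = fun z : ℝ × 𝔼 => ∫⁻ τ : ℝ,
      {q : (ℝ × 𝔼) × ℝ | 0 ≤ q.2 ∧ q.2 ≤ q.1.1}.indicator
        (fun q => greenOp (q.1.1 - q.2) (besselOp (f q.2)) q.1.2) (z, τ) := by
    funext z
    simp only [Function.uncurry, duhamel]
    rw [← lintegral_indicator measurableSet_Icc]
    rfl
  rw [h]
  refine Measurable.lintegral_prod_right' ((measurable_duhamel_integrand hf).indicator ?_)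
  exact (measurableSet_le measurable_const measurable_snd).inter
    (measurableSet_le measurable_snd (measurable_fst.comp measurable_fst))

theorem duhamel_mono : Monotone (duhamel (n := n)) := fun _ _ h _ x =>
  lintegral_mono fun τ => greenOp_mono _ (besselOp_mono (h τ)) x

theorem duhamel_iSup {f : ℕ → ℝ → 𝔼 → ℝ≥0∞} (hf : ∀ j, Measurable (Function.uncurry (f j)))
    (hmono : Monotone f) (t : ℝ) (x : 𝔼) :
    duhamel (fun τ y => ⨆ j, f j τ y) t x = ⨆ j, duhamel (f j) t x := by
  have hsec : ∀ j τ, Measurable (f j τ) := fun j τ => (hf j).comp measurable_prodMk_left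
  have h : ∀ τ, greenOp (t - τ) (besselOp fun y => ⨆ j, f j τ y) x =
      ⨆ j, greenOp (t - τ) (besselOp (f j τ)) x := by
    intro τ
    rw [funext (besselOp_iSup (fun j => hsec j τ) fun i j hij => hmono hij τ)]
    exact greenOp_iSup _ (fun j => measurable_besselOp (hsec j τ))
      (fun i j hij => besselOp_mono (hmono hij τ)) x
  unfold duhamel
  simp_rw [h]
  exact lintegral_iSup (fun j => measurable_duhamel_integrand_right (hf j) t x)
    fun i j hij τ => greenOp_mono _ (besselOp_mono (hmono hij τ)) x

theorem setLIntegral_Icc_exp {K c t : ℝ} (hK : 0 ≤ K) (hc : 0 ≤ c) (ht : 0 ≤ t) :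
    ∫⁻ τ in Icc 0 t, ENNReal.ofReal (K * (c * Real.exp (c * τ))) =
      ENNReal.ofReal (K * (Real.exp (c * t) - 1)) := by
  have hd : ∀ τ ∈ uIcc 0 t, HasDerivAt (fun τ => K * Real.exp (c * τ))
      (K * (c * Real.exp (c * τ))) τ := fun τ _ => by
    have := (((hasDerivAt_id τ).const_mul c).exp).const_mul K
    convert! this using 1
    simp only [id]; ring
  have hcont : Continuous fun τ : ℝ => K * (c * Real.exp (c * τ)) := by fun_prop
  have hint := intervalIntegral.integral_eq_sub_of_hasDerivAt hd (hcont.intervalIntegrable 0 t)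
  rw [intervalIntegral.integral_of_le ht, ← integral_Icc_eq_integral_Ioc] at hint
  rw [← ofReal_integral_eq_lintegral_ofReal (hcont.integrableOn_Icc)
    (Eventually.of_forall fun τ => by positivity), hint]
  simp [mul_sub]

/-- A Gronwall estimate in closed form: the integrand is bounded by `N e^{Ct} w_a(x)` times the
derivative of `e^{Cmτ}`. Adding the bound `N e^{Ct} w_a` of the linear part restores exactly `N
e^{(C+Cm)t} w_a`. -/
theorem IsBesselBound.duhamel_le {a C : ℝ} (hC : IsBesselBound n a C) {f : ℝ → 𝔼 → ℝ≥0∞}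
    {N m t : ℝ} (hN : 0 ≤ N) (hm : 0 ≤ m) (ht : 0 ≤ t)
    (hf : ∀ τ ∈ Icc 0 t, ∀ y, f τ y ≤
      ENNReal.ofReal (m * (N * Real.exp ((C + C * m) * τ)) * weight a y)) (x : 𝔼) :
    duhamel f t x ≤ ENNReal.ofReal
      (N * (Real.exp ((C + C * m) * t) - Real.exp (C * t)) * weight a x) := by
  have h0 : 0 ≤ C := zero_le_one.trans hC.1
  have hx := weight_pos a x
  calc duhamel f t x ≤ ∫⁻ τ in Icc 0 t, ENNReal.ofReal
        (N * Real.exp (C * t) * weight a x * (C * m * Real.exp (C * m * τ))) := by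
        refine setLIntegral_mono (by fun_prop) fun τ hτ => ?_
        have hb := hC.2 (f τ) (m * (N * Real.exp ((C + C * m) * τ))) (by positivity) (hf τ hτ)
        refine (hC.greenOp_le (by positivity) hb (sub_nonneg.2 hτ.2) x).trans_eq ?_
        congr 1
        have h1 : Real.exp (C * t) = Real.exp (C * (t - τ)) * Real.exp (C * τ) := by
          rw [← Real.exp_add]; ring_nf
        rw [h1, add_mul, Real.exp_add]
        ring
    _ = _ := by
        rw [setLIntegral_Icc_exp (by positivity) (by positivity) ht, add_mul, Real.exp_add]
        congr 1
        ring

theorem IsBesselBound.continuous_duhamel {a C : ℝ} (hC : IsBesselBound n a C) (ha : 0 ≤ a)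
    {f : ℝ → 𝔼 → ℝ≥0∞} (hfm : Measurable (Function.uncurry f)) {N t : ℝ} (hN : 0 ≤ N)
    (hf : ∀ τ ∈ Icc 0 t, ∀ y, f τ y ≤ ENNReal.ofReal (N * weight a y)) :
    Continuous (duhamel f t) := by
  have h0 : 0 ≤ C := zero_le_one.trans hC.1
  have hae : ∀ᵐ τ ∂(volume.restrict (Icc 0 t)), τ ∈ Icc 0 t := ae_restrict_mem measurableSet_Icc
  refine continuous_lintegral_of_le (w := weight a)
    (M := fun _ => ENNReal.ofReal (Real.exp (C * t) * (C * N)))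
    ?_ (measurable_duhamel_integrand_right hfm t) (continuous_weight a) (fun x => ?_) ?_
  · filter_upwards [hae] with τ hτ
    exact hC.continuous_greenOp ha
      (continuous_besselOp ha (hfm.comp measurable_prodMk_left) hN (hf τ hτ)) (by positivity)
      (hC.2 _ N hN (hf τ hτ)) (sub_nonneg.2 hτ.2)
  · filter_upwards [hae] with τ hτ
    have hx := weight_pos a x
    rw [← ENNReal.ofReal_mul (by positivity), mul_assoc]
    refine (hC.greenOp_le (by positivity) (hC.2 _ N hN (hf τ hτ)) (sub_nonneg.2 hτ.2) x).trans ?_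
    refine ENNReal.ofReal_le_ofReal ?_
    gcongr
    linarith [hτ.1]
  · rw [lintegral_const]
    exact ENNReal.mul_ne_top ENNReal.ofReal_ne_top (by simp)

theorem duhamel_le_exp_mul {f : ℝ → 𝔼 → ℝ≥0∞} {s t : ℝ} (hst : s ≤ t) (x : 𝔼) :
    duhamel f s x ≤ ENNReal.ofReal (Real.exp (t - s)) * duhamel f t x := by
  unfold duhamel
  rw [← lintegral_const_mul' _ _ ENNReal.ofReal_ne_top]
  refine (setLIntegral_mono' measurableSet_Icc fun τ hτ => ?_).trans
    (lintegral_mono_set (Icc_subset_Icc_right hst))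
  have := greenOp_le_exp_mul (besselOp (f τ)) (sub_nonneg.2 hτ.2) (sub_le_sub_right hst τ) x
  rwa [sub_sub_sub_cancel_right] at this

/-- Split at `s`: the increment of `𝓖` over `[0,s]` yields the summand `C * T`, and the new piece
`(s,t]` yields the summand 1. -/
theorem IsBesselBound.duhamel_le_add {a C : ℝ} (hC : IsBesselBound n a C) {f : ℝ → 𝔼 → ℝ≥0∞}
    {N s t T : ℝ} (hN : 0 ≤ N) (hs : 0 ≤ s) (hst : s ≤ t) (htT : t ≤ T)
    (hf : ∀ τ ∈ Icc 0 T, ∀ y, f τ y ≤ ENNReal.ofReal (N * weight a y)) (x : 𝔼) :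
    duhamel f t x ≤ duhamel f s x + ENNReal.ofReal
      (Real.exp (C * T) * (C * N) * (C * T + 1) * (t - s) * weight a x) := by
  have h0 : 0 ≤ C := zero_le_one.trans hC.1
  have hx := weight_pos a x
  have hb : ∀ τ ∈ Icc 0 T, ∀ y, besselOp (f τ) y ≤ ENNReal.ofReal (C * N * weight a y) :=
    fun τ hτ => hC.2 _ N hN (hf τ hτ)
  have hT : 0 ≤ T := by linarith
  have hts : 0 ≤ t - s := by linarith
  have hdisj : Disjoint (Icc 0 s) (Ioc s t) :=
    Set.disjoint_left.2 fun τ h1 h2 => absurd h1.2 (not_le.2 h2.1)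
  have h1 : ∫⁻ τ in Icc 0 s, greenOp (t - τ) (besselOp (f τ)) x ≤ duhamel f s x +
      ENNReal.ofReal (Real.exp (C * T) * (C * (t - s)) * (C * N * weight a x)) *
        ENNReal.ofReal T := by
    calc _ ≤ ∫⁻ τ in Icc 0 s, (greenOp (s - τ) (besselOp (f τ)) x +
          ENNReal.ofReal (Real.exp (C * T) * (C * (t - s)) * (C * N * weight a x))) := by
          refine setLIntegral_mono' measurableSet_Icc fun τ hτ => ?_
          refine (hC.greenOp_le_add (by positivity)
            (hb τ ⟨hτ.1, hτ.2.trans (hst.trans htT)⟩) (sub_nonneg.2 hτ.2)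
            (sub_le_sub_right hst τ) x).trans ?_
          rw [sub_sub_sub_cancel_right]
          gcongr
          linarith [hτ.1]
      _ = duhamel f s x + ENNReal.ofReal
          (Real.exp (C * T) * (C * (t - s)) * (C * N * weight a x)) * ENNReal.ofReal s := by
          rw [lintegral_add_right _ measurable_const, setLIntegral_const, Real.volume_Icc, sub_zero]
          rfl
      _ ≤ _ := by
          gcongr
          exact hst.trans htT
  have h2 : ∫⁻ τ in Ioc s t, greenOp (t - τ) (besselOp (f τ)) x ≤
      ENNReal.ofReal (Real.exp (C * T) * (C * N * weight a x)) * ENNReal.ofReal (t - s) := by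
    calc _ ≤ ∫⁻ τ in Ioc s t, ENNReal.ofReal (Real.exp (C * T) * (C * N * weight a x)) := by
          refine setLIntegral_mono' measurableSet_Ioc fun τ hτ => ?_
          refine (hC.greenOp_le (by positivity)
            (hb τ ⟨hs.trans hτ.1.le, hτ.2.trans htT⟩) (sub_nonneg.2 hτ.2) x).trans ?_
          gcongr
          linarith [hτ.1]
      _ = _ := by rw [setLIntegral_const, Real.volume_Ioc]
  calc duhamel f t x = (∫⁻ τ in Icc 0 s, greenOp (t - τ) (besselOp (f τ)) x) +
        ∫⁻ τ in Ioc s t, greenOp (t - τ) (besselOp (f τ)) x := by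
        rw [duhamel, ← Icc_union_Ioc_eq_Icc hs hst, lintegral_union measurableSet_Ioc hdisj]
    _ ≤ _ := add_le_add h1 h2
    _ = _ := by
        rw [add_assoc, ← ENNReal.ofReal_mul (by positivity), ← ENNReal.ofReal_mul (by positivity),
          ← ENNReal.ofReal_add (by positivity) (by positivity)]
        congr 2
        ring

/-! ### Monotone iteration -/

/-- The Picard iterates, started from zero, for the mild formulation with potential `v` and
initial value `g`. -/
noncomputable def picard (p : ℝ) (v : ℝ → EuclideanSpace ℝ (Fin n) → ℝ≥0∞)
    (g : EuclideanSpace ℝ (Fin n) → ℝ≥0∞) : ℕ → ℝ → EuclideanSpace ℝ (Fin n) → ℝ≥0∞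
  | 0 => fun _ _ => 0
  | k + 1 => fun t x => greenOp t g x + duhamel (fun τ y => v τ y * picard p v g k τ y ^ p) t x

variable {p : ℝ} {v : ℝ → EuclideanSpace ℝ (Fin n) → ℝ≥0∞}
  {g : EuclideanSpace ℝ (Fin n) → ℝ≥0∞}

theorem measurable_picard (hv : Measurable (Function.uncurry v)) (hg : Measurable g) (k : ℕ) :
    Measurable (Function.uncurry (picard p v g k)) := by
  induction k with
  | zero => exact measurable_const
  | succ k ih =>
    have h1 : Measurable (Function.uncurry fun (t : ℝ) (x : 𝔼) => greenOp t g x) :=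
      measurable_greenOp_param (F := fun _ : ℝ => g) (hg.comp measurable_snd) measurable_id
    exact h1.add (measurable_duhamel (hv.mul (ih.pow_const p)))

theorem picard_monotone (hp : 0 ≤ p) : Monotone (picard p v g) := by
  refine monotone_nat_of_le_succ fun k => ?_
  induction k with
  | zero => exact fun _ _ => zero_le
  | succ k ih =>
    intro t x
    refine add_le_add_right (duhamel_mono (fun τ y => ?_) t x) _
    exact mul_le_mul_right (ENNReal.rpow_le_rpow (ih τ y) hp) _

/-- Monotone convergence passes through the power, both operators and the time integral; no
finiteness is needed. -/
theorem iSup_picard_eq (hp : 0 < p) (hv : Measurable (Function.uncurry v)) (hg : Measurable g)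
    (t : ℝ) (x : 𝔼) :
    ⨆ k, picard p v g k t x =
      greenOp t g x + duhamel (fun τ y => v τ y * (⨆ k, picard p v g k τ y) ^ p) t x := by
  have hmono := picard_monotone (v := v) (g := g) hp.le
  have hrpow : ∀ τ y, v τ y * (⨆ k, picard p v g k τ y) ^ p =
      ⨆ k, v τ y * picard p v g k τ y ^ p := by
    intro τ y
    rw [← ENNReal.mul_iSup]
    congr 1
    exact (ENNReal.orderIsoRpow p hp).map_iSup _
  have hmono' : Monotone fun k τ y => v τ y * picard p v g k τ y ^ p :=
    fun i j hij τ y => mul_le_mul_right (ENNReal.rpow_le_rpow (hmono hij τ y) hp.le) _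
  simp_rw [hrpow]
  rw [duhamel_iSup (fun j => hv.mul ((measurable_picard hv hg j).pow_const p)) hmono',
    ENNReal.add_iSup]
  refine le_antisymm (iSup_le fun k => ?_) (iSup_le fun k => ?_)
  · exact (hmono k.le_succ t x).trans (le_iSup (fun k => greenOp t g x +
      duhamel (fun τ y => v τ y * picard p v g k τ y ^ p) t x) k)
  · exact le_iSup (fun k => picard p v g k t x) (k + 1)

/-- The sublinear source is controlled by the weight of the solution. -/
theorem source_le {a b m K : ℝ} (hp : 0 < p) (hp1 : p < 1) (hab : b + a * p ≤ a) (hm : 0 ≤ m)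
    (hK : 1 ≤ K) {w z : ℝ≥0∞} {y : 𝔼} (hw : w ≤ ENNReal.ofReal (m * weight b y))
    (hz : z ≤ ENNReal.ofReal (K * weight a y)) :
    w * z ^ p ≤ ENNReal.ofReal (m * K * weight a y) := by
  have hb := weight_pos b y
  have hK0 : 0 < K := by linarith
  have hya := weight_pos a y
  calc w * z ^ p ≤ ENNReal.ofReal (m * weight b y) * ENNReal.ofReal (K * weight a y) ^ p :=
        mul_le_mul' hw (ENNReal.rpow_le_rpow hz hp.le)
    _ = ENNReal.ofReal (m * weight b y * (K * weight a y) ^ p) := by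
        rw [ENNReal.ofReal_rpow_of_pos (by positivity), ← ENNReal.ofReal_mul (by positivity)]
    _ ≤ _ := by
        refine ENNReal.ofReal_le_ofReal ?_
        -- Sublinearity enters here: the amplitude bound becomes linear, at the price of `1 ≤ K`.
        have h1 : K ^ p ≤ K := by
          simpa using Real.rpow_le_rpow_of_exponent_le hK hp1.le
        have h2 : weight b y * weight a y ^ p ≤ weight a y := by
          unfold weight
          rw [← Real.rpow_mul (by positivity), ← Real.rpow_add (by positivity)]
          refine Real.rpow_le_rpow_of_exponent_le (by nlinarith [sq_nonneg ‖y‖]) ?_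
          linarith
        rw [Real.mul_rpow hK0.le hya.le]
        calc _ = m * K ^ p * (weight b y * weight a y ^ p) := by ring
          _ ≤ m * K * weight a y := by gcongr

theorem IsBesselBound.picard_le {a b C m A T : ℝ} (hC : IsBesselBound n a C) (hp : 0 < p)
    (hp1 : p < 1) (hab : b + a * p ≤ a) (hm : 0 ≤ m) (hA : 1 ≤ A)
    (hg : ∀ y, g y ≤ ENNReal.ofReal (A * weight a y))
    (hv : ∀ τ ∈ Icc 0 T, ∀ y, v τ y ≤ ENNReal.ofReal (m * weight b y)) (k : ℕ) :
    ∀ t ∈ Icc 0 T, ∀ x, picard p v g k t x ≤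
      ENNReal.ofReal (A * Real.exp ((C + C * m) * t) * weight a x) := by
  have h0 : 0 ≤ C := zero_le_one.trans hC.1
  have hA0 : 0 ≤ A := zero_le_one.trans hA
  induction k with
  | zero => exact fun _ _ _ => zero_le
  | succ k ih =>
    intro t ht x
    have hx := weight_pos a x
    have hd := hC.duhamel_le (f := fun τ y => v τ y * picard p v g k τ y ^ p) hA0 hm ht.1
      (fun τ hτ y => source_le hp hp1 hab hm (one_le_mul_of_one_le_of_one_le hA
        (Real.one_le_exp (mul_nonneg (by positivity) hτ.1))) (hv τ ⟨hτ.1, hτ.2.trans ht.2⟩ y)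
        (ih τ ⟨hτ.1, hτ.2.trans ht.2⟩ y)) x
    have hG := hC.greenOp_le hA0 hg ht.1 x
    have hexp : Real.exp (C * t) ≤ Real.exp ((C + C * m) * t) := by
      have := ht.1
      gcongr
      nlinarith [mul_nonneg h0 hm]
    refine (add_le_add hG hd).trans_eq ?_
    rw [← ENNReal.ofReal_add (by positivity)
      (mul_nonneg (mul_nonneg hA0 (sub_nonneg.2 hexp)) hx.le)]
    congr 1
    ring

/-! ### Weighted norms and growth -/

theorem exists_le_weight_of_isBigO {a : ℝ} (ha : 0 ≤ a) {φ : 𝔼 → ℝ} (hφ : MemBC a φ) :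
    ∃ A : ℝ, 1 ≤ A ∧ ∀ x, |φ x| ≤ A * weight a x := by
  obtain ⟨c, hc⟩ := hφ.2.bound
  obtain ⟨S, hS, hSc⟩ := mem_cocompact.1 hc
  obtain ⟨B, hB⟩ := hS.exists_bound_of_continuousOn hφ.1.continuousOn
  -- The lower bound 1 is what `source_le` requires of the amplitude.
  refine ⟨max (max |c| B) 1, le_max_right _ _, fun x => ?_⟩
  have h1 := one_le_weight ha x
  by_cases hx : x ∈ S
  · calc |φ x| ≤ B := hB x hx
      _ ≤ max (max |c| B) 1 := (le_max_right _ _).trans (le_max_left _ _)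
      _ ≤ _ := le_mul_of_one_le_right (zero_le_one.trans (le_max_right _ _)) h1
  · have h2 : ‖φ x‖ ≤ c * ‖‖x‖ ^ a‖ := hSc hx
    have h3 : ‖x‖ ^ a ≤ weight a x := norm_rpow_le_weight ha x
    rw [Real.norm_of_nonneg (by positivity : 0 ≤ ‖x‖ ^ a), Real.norm_eq_abs] at h2
    calc |φ x| ≤ c * ‖x‖ ^ a := h2
      _ ≤ |c| * ‖x‖ ^ a := by gcongr; exact le_abs_self c
      _ ≤ max (max |c| B) 1 * weight a x := by
          gcongr
          exact (le_max_left _ _).trans (le_max_left _ _)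

theorem memBC_of_le_weight {a A : ℝ} (ha : 0 ≤ a) (hA : 0 ≤ A) {φ : 𝔼 → ℝ} (hc : Continuous φ)
    (hle : ∀ x, |φ x| ≤ A * weight a x) : MemBC a φ := by
  refine ⟨hc, Asymptotics.IsBigO.of_bound (A * 2 ^ (a / 2)) ?_⟩
  filter_upwards [tendsto_norm_cocompact_atTop.eventually (eventually_ge_atTop 1)] with x hx
  rw [Real.norm_of_nonneg (by positivity : 0 ≤ ‖x‖ ^ a), mul_assoc]
  refine (hle x).trans (mul_le_mul_of_nonneg_left ?_ hA)
  calc weight a x ≤ (2 * ‖x‖ ^ (2 : ℝ)) ^ (a / 2) := by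
        refine Real.rpow_le_rpow (by positivity) ?_ (by positivity)
        rw [Real.rpow_two]; nlinarith
    _ = _ := by
        rw [Real.mul_rpow (by norm_num) (by positivity), ← Real.rpow_mul (norm_nonneg x)]
        congr 2; ring

theorem weightedNorm_le {a R D : ℝ} (ha : 0 ≤ a) (hR : 0 < R) (hD : 0 ≤ D) {φ : 𝔼 → ℝ}
    (hle : ∀ x, |φ x| ≤ D * weight a x) :
    weightedNorm R a φ ≤ (min 1 (R ^ 2)) ^ (-a / 2) * D := by
  have hmin : 0 < min 1 (R ^ 2) := lt_min one_pos (by positivity)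
  refine Real.iSup_le (fun x => ?_) (by positivity)
  -- `R²+|x|² ≥ min(1,R²)(1+|x|²)`, raised to a nonpositive power.
  have h1 : (R ^ 2 + ‖x‖ ^ 2) ^ (-a / 2) ≤ (min 1 (R ^ 2) * (1 + ‖x‖ ^ 2)) ^ (-a / 2) := by
    refine Real.rpow_le_rpow_of_nonpos (by positivity) ?_ (by linarith)
    nlinarith [min_le_left 1 (R ^ 2), min_le_right 1 (R ^ 2), sq_nonneg ‖x‖]
  calc _ ≤ (min 1 (R ^ 2) * (1 + ‖x‖ ^ 2)) ^ (-a / 2) * (D * weight a x) := by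
        gcongr
        exact hle x
    _ = (min 1 (R ^ 2)) ^ (-a / 2) * D * ((1 + ‖x‖ ^ 2) ^ (-a / 2) * weight a x) := by
        rw [Real.mul_rpow hmin.le (by positivity)]; ring
    _ = _ := by
        rw [weight, ← Real.rpow_add (by positivity)]
        rw [show -a / 2 + a / 2 = 0 by ring, Real.rpow_zero, mul_one]

theorem weightedNorm_nonneg {a R : ℝ} (φ : 𝔼 → ℝ) : 0 ≤ weightedNorm R a φ :=
  Real.iSup_nonneg fun x => by positivity

theorem memPathBC_of_lipschitz {a : ℝ} (ha : 0 ≤ a) {u : ℝ → 𝔼 → ℝ}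
    (hu : ∀ t, 0 ≤ t → MemBC a (u t))
    (hlip : ∀ T, ∃ L : ℝ, 0 ≤ L ∧ ∀ s ∈ Icc 0 T, ∀ t ∈ Icc 0 T, ∀ x,
      |u s x - u t x| ≤ L * |s - t| * weight a x) : MemPathBC a u := by
  refine ⟨hu, fun R hR t ht => ?_⟩
  obtain ⟨L, hL, h⟩ := hlip (t + 1)
  have hlim : Tendsto (fun s => (min 1 (R ^ 2)) ^ (-a / 2) * (L * |s - t|)) (𝓝[Ici 0] t) (𝓝 0) := by
    have : Continuous fun s => (min 1 (R ^ 2)) ^ (-a / 2) * (L * |s - t|) := by fun_prop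
    have := this.tendsto t
    simp only [sub_self, abs_zero, mul_zero] at this
    exact this.mono_left nhdsWithin_le_nhds
  refine tendsto_of_tendsto_of_tendsto_of_le_of_le' tendsto_const_nhds hlim
    (Eventually.of_forall fun s => weightedNorm_nonneg _) ?_
  filter_upwards [self_mem_nhdsWithin,
    nhdsWithin_le_nhds (gt_mem_nhds (lt_add_one t))] with s hs hst
  exact weightedNorm_le ha hR (by positivity) fun x =>
    h s ⟨hs, hst.le⟩ t ⟨ht, by linarith⟩ x

theorem exists_potential_le {σ : ℝ} {Λ : ℝ → ℝ} {V : 𝔼 → ℝ → ℝ}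
    (hΛc : ContinuousOn Λ (Ici 0)) (hΛ0 : ∀ t, 0 ≤ t → 0 ≤ Λ t)
    (hVc : ContinuousOn (fun z : 𝔼 × ℝ => V z.1 z.2) (univ ×ˢ Ici 0))
    (hV : GrowthBound σ Λ V) (T : ℝ) :
    ∃ m : ℝ, 0 ≤ m ∧ ∀ τ ∈ Icc 0 T, ∀ y, V y τ ≤ m * weight (max σ 0) y := by
  obtain ⟨C, r, h⟩ := hV
  have hK : IsCompact (Metric.closedBall (0 : 𝔼) r ×ˢ Icc 0 T) :=
    (isCompact_closedBall _ _).prod isCompact_Icc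
  obtain ⟨B, hB⟩ := hK.exists_bound_of_continuousOn
    (hVc.mono (prod_mono (subset_univ _) fun t ht => ht.1))
  have hbdd : BddAbove (Λ '' Icc 0 T) :=
    (isCompact_Icc.image_of_continuousOn (hΛc.mono fun t ht => ht.1)).bddAbove
  have hb : 0 ≤ max σ 0 := le_max_right _ _
  have hS0 : 0 ≤ sSup (Λ '' Icc 0 T) := Real.sSup_nonneg (by
    rintro _ ⟨t, ht, rfl⟩; exact hΛ0 t ht.1)
  -- The first summand serves outside the ball, the second inside. Absolute values are needed as `C`
  -- has no prescribed sign, nor has `B` if the compact set is empty.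
  refine ⟨|C| * sSup (Λ '' Icc 0 T) + |B|, by positivity, fun τ hτ y => ?_⟩
  have h1 := one_le_weight hb y
  rcases le_total r ‖y‖ with hy | hy
  · have hS : sSup (Λ '' Icc 0 τ) ≤ sSup (Λ '' Icc 0 T) :=
      csSup_le_csSup hbdd ⟨Λ τ, τ, ⟨hτ.1, le_rfl⟩, rfl⟩
        (image_mono (Icc_subset_Icc_right hτ.2))
    have hSτ : 0 ≤ sSup (Λ '' Icc 0 τ) := Real.sSup_nonneg (by
      rintro _ ⟨t, ht, rfl⟩; exact hΛ0 t ht.1)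
    have h3 : ‖y‖ ^ max σ 0 ≤ weight (max σ 0) y := norm_rpow_le_weight hb y
    calc V y τ ≤ C * sSup (Λ '' Icc 0 τ) * ‖y‖ ^ max σ 0 := h τ hτ.1 y hy
      _ ≤ |C| * sSup (Λ '' Icc 0 τ) * ‖y‖ ^ max σ 0 := by gcongr; exact le_abs_self C
      _ ≤ (|C| * sSup (Λ '' Icc 0 T) + |B|) * weight (max σ 0) y := by
          gcongr
          exact (mul_le_mul_of_nonneg_left hS (abs_nonneg C)).trans
            (le_add_of_nonneg_right (abs_nonneg B))
  · have h2 : |V y τ| ≤ B := hB (y, τ) ⟨by simpa using hy, hτ⟩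
    calc V y τ ≤ |B| := (le_abs_self _).trans (h2.trans (le_abs_self B))
      _ ≤ |C| * sSup (Λ '' Icc 0 T) + |B| := le_add_of_nonneg_left (by positivity)
      _ ≤ _ := le_mul_of_one_le_right (by positivity) h1

/-- Solutions of the mild formulation that are dominated, together with their source, by the
weight on bounded time intervals form continuous paths in `BC_a`. -/
theorem memPathBC_of_duhamel {a C A : ℝ} (hC : IsBesselBound n a C) (ha : 0 ≤ a)
    {g : EuclideanSpace ℝ (Fin n) → ℝ≥0∞} (hgc : Continuous g) (hA : 0 ≤ A)
    (hg : ∀ y, g y ≤ ENNReal.ofReal (A * weight a y))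
    {f U : ℝ → EuclideanSpace ℝ (Fin n) → ℝ≥0∞} (hf : Measurable (Function.uncurry f))
    (hU : ∀ t x, U t x = greenOp t g x + duhamel f t x)
    (hbound : ∀ T, ∃ K N : ℝ, 0 ≤ K ∧ 0 ≤ N ∧ ∀ τ ∈ Icc 0 T, ∀ y,
      U τ y ≤ ENNReal.ofReal (K * weight a y) ∧ f τ y ≤ ENNReal.ofReal (N * weight a y)) :
    MemPathBC a fun t x => (U t x).toReal := by
  have h0 : 0 ≤ C := zero_le_one.trans hC.1
  have hfin : ∀ t, 0 ≤ t → ∀ x, U t x ≠ ⊤ := fun t ht x => by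
    obtain ⟨K, N, -, -, h⟩ := hbound t
    exact ne_top_of_le_ne_top ENNReal.ofReal_ne_top (h t ⟨ht, le_rfl⟩ x).1
  refine memPathBC_of_lipschitz ha (fun t ht => ?_) fun T => ?_
  · obtain ⟨K, N, hK, hN, h⟩ := hbound t
    have hcont : Continuous (U t) := by
      rw [funext (hU t)]
      exact (hC.continuous_greenOp ha hgc hA hg ht).add
        (hC.continuous_duhamel ha hf hN fun τ hτ y => (h τ hτ y).2)
    refine memBC_of_le_weight ha hK (continuous_iff_continuousAt.2 fun x =>
      (ENNReal.tendsto_toReal (hfin t ht x)).comp hcont.continuousAt) fun x => ?_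
    rw [abs_of_nonneg ENNReal.toReal_nonneg]
    exact ENNReal.toReal_le_of_le_ofReal (mul_nonneg hK (weight_pos a x).le)
      (h t ⟨ht, le_rfl⟩ x).1
  · obtain ⟨K, N, hK, hN, h⟩ := hbound T
    set D := Real.exp (C * T) * (C * A) + Real.exp (C * T) * (C * N) * (C * |T| + 1) +
      Real.exp T * K with hD
    have hD0 : 0 ≤ D := by positivity
    have key : ∀ s t, 0 ≤ s → s ≤ t → t ≤ T → ∀ x,
        |(U s x).toReal - (U t x).toReal| ≤ D * (t - s) * weight a x := by
      intro s t hs hst htT x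
      have hT : 0 ≤ T := by linarith
      have ht : 0 ≤ t := by linarith
      have hts : 0 ≤ t - s := by linarith
      have hx := weight_pos a x
      have hup : U t x ≤ U s x + ENNReal.ofReal
          ((Real.exp (C * T) * (C * A) + Real.exp (C * T) * (C * N) * (C * |T| + 1)) *
            (t - s) * weight a x) := by
        have h1 := hC.greenOp_le_add hA hg hs hst x
        have h2 := hC.duhamel_le_add hN hs hst htT (fun τ hτ y => (h τ hτ y).2) x
        rw [hU t, hU s]
        refine (add_le_add h1 h2).trans ?_
        rw [add_add_add_comm, ← ENNReal.ofReal_add (by positivity) (by positivity)]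
        refine add_le_add_right (ENNReal.ofReal_le_ofReal ?_) _
        rw [abs_of_nonneg hT]
        calc _ ≤ Real.exp (C * T) * (C * (t - s)) * (A * weight a x) +
              Real.exp (C * T) * (C * N) * (C * T + 1) * (t - s) * weight a x := by gcongr
          _ = _ := by ring
      -- This gives `U s - U t ≤ (e^{t-s} - 1) U t`, the source of the term `e^T K` in `D`.
      have hdown : U s x ≤ ENNReal.ofReal (Real.exp (t - s)) * U t x := by
        rw [hU t, hU s, mul_add]
        exact add_le_add (greenOp_le_exp_mul g hs hst x) (duhamel_le_exp_mul hst x)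
      have hKt := ENNReal.toReal_le_of_le_ofReal (mul_nonneg hK hx.le) (h t ⟨ht, htT⟩ x).1
      have hup' := ENNReal.toReal_mono
        (ENNReal.add_ne_top.2 ⟨hfin s hs x, ENNReal.ofReal_ne_top⟩) hup
      have hdown' := ENNReal.toReal_mono
        (ENNReal.mul_ne_top ENNReal.ofReal_ne_top (hfin t ht x)) hdown
      rw [ENNReal.toReal_add (hfin s hs x) ENNReal.ofReal_ne_top,
        ENNReal.toReal_ofReal (by positivity)] at hup'
      rw [ENNReal.toReal_mul, ENNReal.toReal_ofReal (Real.exp_nonneg _)] at hdown'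
      have hut : 0 ≤ (U t x).toReal := ENNReal.toReal_nonneg
      have hexp : Real.exp (t - s) - 1 ≤ Real.exp T * (t - s) := by
        have h1 := exp_sub_exp_le 0 (t - s)
        rw [Real.exp_zero, sub_zero] at h1
        refine h1.trans ?_
        gcongr
        linarith
      have h3 : (Real.exp (t - s) - 1) * (U t x).toReal ≤
          Real.exp T * (t - s) * (K * weight a x) :=
        mul_le_mul hexp hKt hut (by positivity)
      have h4 : 0 ≤ (Real.exp (C * T) * (C * A) +
        Real.exp (C * T) * (C * N) * (C * |T| + 1)) * (t - s) * weight a x := by positivity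
      have h5 : 0 ≤ Real.exp T * K * (t - s) * weight a x := by positivity
      rw [abs_le, hD]
      constructor <;> linarith
    refine ⟨D, hD0, fun s hs t ht x => ?_⟩
    rcases le_total s t with hst | hst
    · rw [abs_sub_comm s t, abs_of_nonneg (sub_nonneg.2 hst)]
      exact key s t hs.1 hst ht.2 x
    · rw [abs_sub_comm, abs_of_nonneg (sub_nonneg.2 hst)]
      exact key t s ht.1 hst hs.2 x

theorem exists_isGlobalMildSolution {p : ℝ} (hp0 : 0 < p) (hp1 : p < 1) {σ a : ℝ}
    (ha : max σ 0 / (1 - p) ≤ a)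
    {Λ : ℝ → ℝ} (hΛc : ContinuousOn Λ (Ici 0)) (hΛ0 : ∀ t, 0 ≤ t → 0 ≤ Λ t)
    {V : EuclideanSpace ℝ (Fin n) → ℝ → ℝ}
    (hVc : ContinuousOn (fun z : EuclideanSpace ℝ (Fin n) × ℝ => V z.1 z.2) (univ ×ˢ Ici 0))
    (hV0 : ∀ x t, 0 ≤ t → 0 ≤ V x t) (hV : GrowthBound σ Λ V)
    {u₀ : EuclideanSpace ℝ (Fin n) → ℝ} (hu₀ : MemBC a u₀) :
    ∃ u : ℝ → EuclideanSpace ℝ (Fin n) → ℝ, IsGlobalMildSolution p a V u₀ u := by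
  have hp1' : 0 < 1 - p := sub_pos.2 hp1
  have ha0 : 0 ≤ a := (div_nonneg (le_max_right σ 0) hp1'.le).trans ha
  have hab : max σ 0 + a * p ≤ a := by
    rw [div_le_iff₀ hp1'] at ha
    linarith
  obtain ⟨C, hC⟩ := exists_isBesselBound (n := n) ha0
  obtain ⟨A, hA, hAu⟩ := exists_le_weight_of_isBigO ha0 hu₀
  have hA0 : 0 ≤ A := zero_le_one.trans hA
  set g : EuclideanSpace ℝ (Fin n) → ℝ≥0∞ := fun y => ENNReal.ofReal (u₀ y)
  -- Freezing the potential at negative times makes it continuous everywhere, hence measurable,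
  -- without change for `τ ≥ 0`.
  set v : ℝ → EuclideanSpace ℝ (Fin n) → ℝ≥0∞ := fun τ y => ENNReal.ofReal (V y (max τ 0))
  have hgc : Continuous g := ENNReal.continuous_ofReal.comp hu₀.1
  have hg : ∀ y, g y ≤ ENNReal.ofReal (A * weight a y) := fun y =>
    ENNReal.ofReal_le_ofReal ((le_abs_self _).trans (hAu y))
  have hv : Measurable (Function.uncurry v) := by
    refine Continuous.measurable (ENNReal.continuous_ofReal.comp ?_)
    exact hVc.comp_continuous
      (f := fun z : ℝ × EuclideanSpace ℝ (Fin n) => (z.2, max z.1 0)) (by fun_prop)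
      fun z => ⟨mem_univ _, le_max_right z.1 0⟩
  set U : ℝ → EuclideanSpace ℝ (Fin n) → ℝ≥0∞ := fun t x => ⨆ k, picard p v g k t x
  have hUm : Measurable (Function.uncurry U) :=
    Measurable.iSup fun k => measurable_picard hv hgc.measurable k
  have hU : ∀ t x, U t x = greenOp t g x + duhamel (fun τ y => v τ y * U τ y ^ p) t x :=
    iSup_picard_eq hp0 hv hgc.measurable
  have hbound : ∀ T, ∃ K N : ℝ, 0 ≤ K ∧ 0 ≤ N ∧ ∀ τ ∈ Icc 0 T, ∀ y,
      U τ y ≤ ENNReal.ofReal (K * weight a y) ∧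
        v τ y * U τ y ^ p ≤ ENNReal.ofReal (N * weight a y) := by
    intro T
    obtain ⟨m, hm, hVm⟩ := exists_potential_le hΛc hΛ0 hVc hV T
    have h0 : 0 ≤ C := zero_le_one.trans hC.1
    have hvm : ∀ τ ∈ Icc 0 T, ∀ y, v τ y ≤ ENNReal.ofReal (m * weight (max σ 0) y) :=
      fun τ hτ y => ENNReal.ofReal_le_ofReal (by rw [max_eq_left hτ.1]; exact hVm τ hτ y)
    set K := A * Real.exp ((C + C * m) * |T|)
    have hK : 1 ≤ K := one_le_mul_of_one_le_of_one_le hA (Real.one_le_exp (by positivity))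
    have hUK : ∀ τ ∈ Icc 0 T, ∀ y, U τ y ≤ ENNReal.ofReal (K * weight a y) := by
      refine fun τ hτ y => iSup_le fun k =>
        (hC.picard_le hp0 hp1 hab hm hA hg hvm k τ hτ y).trans (ENNReal.ofReal_le_ofReal ?_)
      have := weight_pos a y
      have := hτ.2.trans (le_abs_self T)
      simp only [K]
      gcongr
    exact ⟨K, m * K, by positivity, by positivity, fun τ hτ y => ⟨hUK τ hτ y,
      source_le hp0 hp1 hab hm hK (hvm τ hτ y) (hUK τ hτ y)⟩⟩
  have hfin : ∀ t, 0 ≤ t → ∀ x, U t x ≠ ⊤ := fun t ht x => by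
    obtain ⟨K, N, -, -, h⟩ := hbound t
    exact ne_top_of_le_ne_top ENNReal.ofReal_ne_top (h t ⟨ht, le_rfl⟩ x).1
  refine ⟨fun t x => (U t x).toReal, memPathBC_of_duhamel hC ha0 hgc hA0 hg
    (f := fun τ y => v τ y * U τ y ^ p) (hv.mul (hUm.pow_const p)) hU hbound,
    fun t _ x => ENNReal.toReal_nonneg, fun t ht x => ?_⟩
  rw [ENNReal.ofReal_toReal (hfin t ht x), hU t x]
  congr 1
  refine setLIntegral_congr_fun measurableSet_Icc fun τ hτ => ?_
  -- Since `U` is finite for `τ ≥ 0`, the extended and the real powers agree.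
  have hsrc : (fun y => v τ y * U τ y ^ p) =
      fun y => ENNReal.ofReal (V y τ * (U τ y).toReal ^ p) := by
    funext y
    rw [ENNReal.ofReal_mul (hV0 y τ hτ.1),
      ← ENNReal.ofReal_rpow_of_nonneg ENNReal.toReal_nonneg hp0.le,
      ENNReal.ofReal_toReal (hfin τ hτ.1 y)]
    simp only [v, max_eq_left hτ.1]
  simp only [hsrc]

end Pseudoparabolic

theorem theorem3 (n : ℕ) (hn : 1 ≤ n) (p : ℝ) (hp0 : 0 < p) (hp1 : p < 1) (σ a : ℝ)
    (ha : max σ 0 / (1 - p) ≤ a)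
    (Λ : ℝ → ℝ) (hΛc : ContinuousOn Λ (Set.Ici 0)) (hΛ0 : ∀ t, 0 ≤ t → 0 ≤ Λ t)
    (V : EuclideanSpace ℝ (Fin n) → ℝ → ℝ)
    (hVc : ContinuousOn (fun z : EuclideanSpace ℝ (Fin n) × ℝ => V z.1 z.2)
      (Set.univ ×ˢ Set.Ici 0))
    (hV0 : ∀ x t, 0 ≤ t → 0 ≤ V x t)
    (hV : Pseudoparabolic.GrowthBound σ Λ V)
    (u₀ : EuclideanSpace ℝ (Fin n) → ℝ) (hu₀ : Pseudoparabolic.MemBC a u₀)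
    (hu₀0 : ∀ x, 0 ≤ u₀ x) :
    ∃ u : ℝ → EuclideanSpace ℝ (Fin n) → ℝ,
      Pseudoparabolic.IsGlobalMildSolution p a V u₀ u := by
  exact Pseudoparabolic.exists_isGlobalMildSolution hp0 hp1 ha hΛc hΛ0 hVc hV0 hV hu₀
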